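/- Let $n,m\in\mathbb{N}$ and consider the control-affine system $$x_{k+1}=f(x_k)+g(x_k)u_k+w_k,\qquad k=0,1,2,\dots,$$ with state $x_k\in\mathbb{R}^n$, control $u_k\in\mathbb{R}^m$, arbitrary functions $f:\mathbb{R}^n\to\mathbb{R}^n$ and $g:\mathbb{R}^n\to\mathbb{R}^{n\times m}$, and independent Gaussian noise vectors $w_k\sim\mathcal{N}(\mu_w,\Sigma_w)$, where $\mu_w\in\mathbb{R}^n$ is arbitrary (possibly non-zero) and $\Sigma_w\succeq 0$. Assume that $\Sigma_w\preceq\sigma I$ for a real number $\sigma>0$. Let $\delta>0$ and let $t\ge 2$ be an integer. Put $$\widehat\mu_w=\frac1t\sum_{k=0}^{t-1}w_k,\qquad \widehat\Sigma_w=\frac1{t-1}\sum_{k=0}^{t-1}(w_k-\widehat\mu_w)(w_k-\widehat\mu_w)^\top,$$ and let $\Omega\subseteq\mathbb{R}^n$ be the (random) set of all $w$ for which there is $a\in\mathbb{R}^n$ with $a^\top a\le \frac{3n\sigma}{t\delta}$ and $$(w-\widehat\mu_w-a)^\top\left(\widehat\Sigma_w+\sigma\sqrt{\frac{3n(n+1)}{\delta(t-1)}}\,I\right)^{-1}(w-\widehat\mu_w-a)\le\frac{3n}{\delta}.$$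 Let $H_{t+1}$ be a real matrix with $n$ columns and $h_{t+1}$ a real vector with as many entries as $H_{t+1}$ has rows; a state $x_{t+1}$ is called safe if $H_{t+1}x_{t+1}\le h_{t+1}$ element-wise. Given a (random) nominal control $\bar u_t\in\mathbb{R}^m$ and a real-valued function $\mathbf d$ on $\mathbb{R}^m\times\mathbb{R}^m$ (for example a distance), consider the robust program $$\min_{u\in\mathbb{R}^m}\ \mathbf d(u,\bar u_t)\quad\text{subject to}\quad H_{t+1}\bigl(f(x_t)+g(x_t)u+w\bigr)\le h_{t+1}\ \text{ for all } w\in\Omega ,$$ and suppose that, almost surely, $u_t$ is a minimizer of this program whenever the program is feasible. Then $$\mathbb{P}\{\text{the program is feasible and } x_{t+1}\text{ is not safe}\}\le\delta .$$ In particular, if the program is almost surely feasible, then $$\mathbb{P}\{H_{t+1}x_{t+1}\le h_{t+1}\}\ge 1-\delta .$$ -/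

import Mathlib

open MeasureTheory ProbabilityTheory Matrix

noncomputable section

namespace SafeLearning

/-- Column vectors with the Euclidean norm. -/
abbrev Vec (n : ℕ) := EuclideanSpace ℝ (Fin n)

variable {n m p : ℕ}

/-- One step of the control-affine system: `f(x) + g(x) u + w`. -/
def step (f : Vec n → Vec n) (g : Vec n → Matrix (Fin n) (Fin m) ℝ)
    (x : Vec n) (u : Vec m) (w : Vec n) : Vec n :=
  f x + WithLp.toLp 2 (g x *ᵥ u.ofLp) + w

/-- The safety constraint `H x ≤ h`, element-wise. -/
def IsSafe (H : Matrix (Fin p) (Fin n) ℝ) (h : Fin p → ℝ) (x : Vec n) : Prop :=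
  ∀ i, (H *ᵥ x.ofLp) i ≤ h i

/-- Empirical mean of `w 0, …, w (t-1)`. -/
def empMean (w : ℕ → Vec n) (t : ℕ) : Vec n :=
  (1 / (t : ℝ)) • ∑ k ∈ Finset.range t, w k

/-- Empirical covariance of `w 0, …, w (t-1)`, with the normalization `1 / (t - 1)`. -/
def empCov (w : ℕ → Vec n) (t : ℕ) : Matrix (Fin n) (Fin n) ℝ :=
  (1 / ((t : ℝ) - 1)) • ∑ k ∈ Finset.range t,
    vecMulVec (w k - empMean w t).ofLp (w k - empMean w t).ofLp

/-- The inflated empirical covariance. -/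
def inflatedCov (σ δ : ℝ) (w : ℕ → Vec n) (t : ℕ) : Matrix (Fin n) (Fin n) ℝ :=
  empCov w t +
    (σ * Real.sqrt (3 * (n : ℝ) * ((n : ℝ) + 1) / (δ * ((t : ℝ) - 1)))) •
      (1 : Matrix (Fin n) (Fin n) ℝ)

/-- The uncertainty set: all `v` such that, for some `a` in the ball `aᵀ a ≤ 3nσ / (tδ)`, the point
`v - a` lies in the ellipsoid of the inflated covariance centred at the empirical mean. -/
def uncertaintySet (σ δ : ℝ) (w : ℕ → Vec n) (t : ℕ) : Set (Vec n) :=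
  {v | ∃ a : Vec n,
    a.ofLp ⬝ᵥ a.ofLp ≤ 3 * (n : ℝ) * σ / ((t : ℝ) * δ) ∧
    (v - empMean w t - a).ofLp ⬝ᵥ
      ((inflatedCov σ δ w t)⁻¹ *ᵥ (v - empMean w t - a).ofLp) ≤ 3 * (n : ℝ) / δ}

/-- The feasible set of the robust program at the state `x`: the controls that make the next state
safe for every disturbance in `W`. -/
def feasibleControls (f : Vec n → Vec n) (g : Vec n → Matrix (Fin n) (Fin m) ℝ)
    (H : Matrix (Fin p) (Fin n) ℝ) (h : Fin p → ℝ) (W : Set (Vec n)) (x : Vec n) :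
    Set (Vec m) :=
  {u | ∀ w ∈ W, IsSafe H h (step f g x u w)}

/-- The minimizers of `d(·, ubar)` over the set `S` of controls. -/
def argminControls (d : Vec m → Vec m → ℝ) (ubar : Vec m) (S : Set (Vec m)) : Set (Vec m) :=
  {u | u ∈ S ∧ ∀ v ∈ S, d u ubar ≤ d v ubar}

end SafeLearning

end

/-! Three events of probability at most `δ / 3` each are discarded by Chebyshev's inequality: that
the sample mean is far from `μ`, that the sample covariance is far from `S` in the Frobenius norm,
and that `w t` leaves the ellipsoid `{μ + S^(1/2) ξ : ‖ξ‖² ≤ 3n/δ}`. The second one needs the fourth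
moments of the sample: the residuals are jointly Gaussian, with covariances the entries of the
centering projection times those of `S`, so Isserlis' formula gives the entry `(i, j)` of the sample
covariance the variance `(S i i * S j j + S i j ^ 2) / (t - 1)`.

Outside the three events the inflated covariance dominates `S`, and a Schur complement bounds its
inverse on the ellipsoid; so `w t` lies in the uncertainty set, with `a` the error `μ - μ̂` of the
sample mean, and every feasible control keeps the next state safe. -/

namespace SafeLearning

open scoped MatrixOrder

section GaussianMoments

open Polynomial in
lemma deriv_exp_mul_eval (v : ℝ) (q : ℝ[X]) :
    deriv (fun s => Real.exp (v * s ^ 2 / 2) * q.eval s) =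
      fun s => Real.exp (v * s ^ 2 / 2) * (C v * X * q + derivative q).eval s := by
  funext s
  have hquad : HasDerivAt (fun s : ℝ => v * s ^ 2 / 2) (v * s) s :=
    (((hasDerivAt_pow 2 s).const_mul v).div_const 2).congr_deriv (by norm_num; ring)
  rw [(hquad.exp.fun_mul (q.hasDerivAt s)).deriv]
  simp only [eval_add, eval_mul, eval_C, eval_X]
  ring

open Polynomial in
lemma iteratedDeriv_four_exp_mul_sq (v : ℝ) :
    iteratedDeriv 4 (fun s : ℝ => Real.exp (v * s ^ 2 / 2)) 0 = 3 * v ^ 2 := by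
  have hone : (fun s : ℝ => Real.exp (v * s ^ 2 / 2)) =
      fun s => Real.exp (v * s ^ 2 / 2) * (1 : ℝ[X]).eval s := by simp
  rw [hone]
  simp only [iteratedDeriv_succ, iteratedDeriv_zero, deriv_exp_mul_eval]
  simp only [derivative_add, derivative_mul, derivative_C, derivative_X, derivative_one,
    derivative_zero, eval_add, eval_mul, eval_C, eval_X, eval_one, eval_zero]
  norm_num
  ring

variable {Ω : Type*} [MeasurableSpace Ω] {P : Measure Ω}

lemma integral_pow_four_of_hasGaussianLaw {X : Ω → ℝ} (hX : HasGaussianLaw X P)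
    (hmean : P[X] = 0) : ∫ ω, X ω ^ 4 ∂P = 3 * Var[X; P] ^ 2 := by
  have hlaw := hX.map_eq_gaussianReal
  rw [hmean] at hlaw
  have hmgf : mgf X P = fun s => Real.exp (Var[X; P] * s ^ 2 / 2) := by
    funext s
    rw [mgf_gaussianReal hlaw s, Real.coe_toNNReal _ (variance_nonneg _ _), zero_mul, zero_add]
  have hexp : integrableExpSet X P = Set.univ := by
    refine Set.eq_univ_of_forall fun s => ?_
    have hs : s ∈ integrableExpSet (id : ℝ → ℝ) (P.map X) := by
      rw [hlaw, integrableExpSet_id_gaussianReal]; trivial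
    exact (integrable_map_measure (by fun_prop) hX.aemeasurable).1 hs
  have hmoment := iteratedDeriv_mgf_zero (X := X) (μ := P) (by simp [hexp]) 4
  rw [hmgf, iteratedDeriv_four_exp_mul_sq] at hmoment
  simpa only [Pi.pow_apply] using hmoment.symm

lemma memLp_mul_of_hasGaussianLaw {X Y : Ω → ℝ} (hX : HasGaussianLaw X P)
    (hY : HasGaussianLaw Y P) : MemLp (fun ω => X ω * Y ω) 2 P := by
  have : ENNReal.HolderTriple 4 4 2 := ⟨by
    rw [← ENNReal.toReal_eq_toReal_iff' (by simp) (by simp),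
      ENNReal.toReal_add (by simp) (by simp)]
    norm_num⟩
  exact (hY.memLp (p := 4) (by simp)).mul' (hX.memLp (p := 4) (by simp))

lemma covariance_eq_integral_mul {Y Z : Ω → ℝ} (hY : P[Y] = 0) (hZ : P[Z] = 0) :
    cov[Y, Z; P] = ∫ ω, Y ω * Z ω ∂P := by
  simp only [covariance, hY, hZ, sub_zero]

variable {T : Type*} [Finite T] {X : T → Ω → ℝ}

lemma hasGaussianLaw_sum_mul {ι : Type*} [Fintype ι] (hX : HasGaussianLaw (fun ω => (X · ω)) P)
    (c : ι → ℝ) (q : ι → T) : HasGaussianLaw (fun ω => ∑ a, c a * X (q a) ω) P := by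
  have := Fintype.ofFinite T
  convert! hX.map_fun (∑ a, c a • ContinuousLinearMap.proj (R := ℝ) (φ := fun _ : T => ℝ) (q a))
  simp

lemma integral_sum_mul_pow_four (hX : HasGaussianLaw (fun ω => (X · ω)) P)
    (hmean : ∀ i, P[X i] = 0) {ι : Type*} [Fintype ι] (c : ι → ℝ) (q : ι → T) :
    ∫ ω, (∑ a, c a * X (q a) ω) ^ 4 ∂P =
      3 * (∑ a, ∑ b, c a * c b * cov[X (q a), X (q b); P]) ^ 2 := by
  have := hX.isProbabilityMeasure
  have hmean_sum : P[fun ω => ∑ a, c a * X (q a) ω] = 0 := by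
    rw [integral_finsetSum _ fun a _ => ((hX.eval (q a)).integrable.const_mul (c a))]
    simp only [integral_const_mul, hmean, mul_zero, Finset.sum_const_zero]
  rw [integral_pow_four_of_hasGaussianLaw (hasGaussianLaw_sum_mul hX c q) hmean_sum,
    variance_fun_sum fun a => ((hX.eval (q a)).memLp_two.const_mul (c a))]
  simp only [covariance_const_mul_left, covariance_const_mul_right, mul_left_comm, mul_assoc]

lemma integral_mul_four_of_hasGaussianLaw (hX : HasGaussianLaw (fun ω => (X · ω)) P)
    (hmean : ∀ i, P[X i] = 0) (i j k l : T) :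
    ∫ ω, X i ω * X j ω * (X k ω * X l ω) ∂P =
      cov[X i, X j; P] * cov[X k, X l; P] + cov[X i, X k; P] * cov[X j, X l; P] +
        cov[X i, X l; P] * cov[X j, X k; P] := by
  -- Polarization: `192 a b c d` is the signed sum of the fourth powers `(a ± b ± c ± d) ^ 4`.
  let signs : Finset (ℝ × ℝ × ℝ) := {1, -1} ×ˢ {1, -1} ×ˢ {1, -1}
  have sum_signs : ∀ F : ℝ × ℝ × ℝ → ℝ, ∑ ε ∈ signs, F ε =
      F (1, 1, 1) + F (1, 1, -1) + (F (1, -1, 1) + F (1, -1, -1)) +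
        (F (-1, 1, 1) + F (-1, 1, -1) + (F (-1, -1, 1) + F (-1, -1, -1))) := fun F => by
    simp only [signs, Finset.sum_product, Finset.sum_pair (show (1 : ℝ) ≠ -1 by norm_num)]
  have hpolar : ∀ ω, X i ω * X j ω * (X k ω * X l ω) = (∑ ε ∈ signs, ε.1 * ε.2.1 * ε.2.2 *
      (∑ a, ![1, ε.1, ε.2.1, ε.2.2] a * X (![i, j, k, l] a) ω) ^ 4) / 192 := fun ω => by
    simp only [sum_signs, Fin.sum_univ_four, cons_val]
    ring
  have hint : ∀ c : Fin 4 → ℝ,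
      Integrable (fun ω => (∑ a, c a * X (![i, j, k, l] a) ω) ^ 4) P := fun c => by
    have := (hasGaussianLaw_sum_mul hX c ![i, j, k, l]).memLp (p := 4) (by simp)
    simpa only [Real.norm_eq_abs, (show Even 4 by decide).pow_abs] using
      this.integrable_norm_pow (by norm_num)
  simp_rw [hpolar, integral_div]
  rw [integral_finsetSum _ fun ε _ => (hint _).const_mul _]
  simp_rw [integral_const_mul, integral_sum_mul_pow_four hX hmean]
  simp only [sum_signs, Fin.sum_univ_four, cons_val]
  rw [covariance_comm (X j) (X i), covariance_comm (X k) (X i), covariance_comm (X l) (X i),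
    covariance_comm (X k) (X j), covariance_comm (X l) (X j), covariance_comm (X l) (X k)]
  ring

lemma covariance_mul_mul_of_hasGaussianLaw (hX : HasGaussianLaw (fun ω => (X · ω)) P)
    (hmean : ∀ i, P[X i] = 0) (i j k l : T) :
    cov[fun ω => X i ω * X j ω, fun ω => X k ω * X l ω; P] =
      cov[X i, X k; P] * cov[X j, X l; P] + cov[X i, X l; P] * cov[X j, X k; P] := by
  have := hX.isProbabilityMeasure
  rw [covariance_eq_sub (memLp_mul_of_hasGaussianLaw (hX.eval i) (hX.eval j))
    (memLp_mul_of_hasGaussianLaw (hX.eval k) (hX.eval l))]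
  simp only [Pi.mul_apply, integral_mul_four_of_hasGaussianLaw hX hmean,
    ← covariance_eq_integral_mul (hmean _) (hmean _)]
  ring

end GaussianMoments

section MatrixBounds

variable {ι κ : Type*} [Fintype ι] [Fintype κ]

open scoped Classical in
lemma sqrt_mul_transpose_sqrt {S : Matrix ι ι ℝ} (hS : S.PosSemidef) :
    CFC.sqrt S * (CFC.sqrt S)ᵀ = S := by
  have hsymm : (CFC.sqrt S)ᴴ = CFC.sqrt S := (CFC.sqrt_nonneg S).isSelfAdjoint
  rw [← conjTranspose_eq_transpose_of_trivial, hsymm, CFC.sqrt_mul_sqrt_self _ hS.nonneg]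

lemma trace_mul_nonneg {A B : Matrix ι ι ℝ} (hA : A.PosSemidef) (hB : B.PosSemidef) :
    0 ≤ (A * B).trace := by
  classical
  rw [← sqrt_mul_transpose_sqrt hA, mul_assoc, trace_mul_comm]
  simpa only [conjTranspose_eq_transpose_of_trivial, transpose_transpose] using
    (hB.mul_mul_conjTranspose_same (CFC.sqrt A)ᵀ).trace_nonneg

lemma trace_mul_self_eq_sum_sq {S : Matrix ι ι ℝ} (hS : S.IsHermitian) :
    (S * S).trace = ∑ i, ∑ j, S i j ^ 2 := by
  have hsymm : ∀ i j, S j i = S i j := fun i j => by simpa using hS.apply i j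
  simp only [trace, diag_apply, mul_apply, pow_two, hsymm]

lemma dotProduct_mulVec_sq_le (E : Matrix ι ι ℝ) (v : ι → ℝ) :
    (v ⬝ᵥ (E *ᵥ v)) ^ 2 ≤ (∑ i, ∑ j, E i j ^ 2) * (v ⬝ᵥ v) ^ 2 := by
  calc (v ⬝ᵥ (E *ᵥ v)) ^ 2 = (∑ q : ι × ι, E q.1 q.2 * (v q.1 * v q.2)) ^ 2 := by
        simp only [Fintype.sum_prod_type, dotProduct, mulVec, Finset.mul_sum, mul_left_comm]
    _ ≤ (∑ q : ι × ι, E q.1 q.2 ^ 2) * ∑ q : ι × ι, (v q.1 * v q.2) ^ 2 :=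
        Finset.sum_mul_sq_le_sq_mul_sq _ _ _
    _ = (∑ i, ∑ j, E i j ^ 2) * (v ⬝ᵥ v) ^ 2 := by
        simp only [Fintype.sum_prod_type, mul_pow, dotProduct, ← pow_two, ← Finset.mul_sum]
        rw [← Finset.sum_mul, ← pow_two]

variable [DecidableEq ι]

lemma trace_le_of_posSemidef_sub {S : Matrix ι ι ℝ} {σ : ℝ}
    (h : (σ • (1 : Matrix ι ι ℝ) - S).PosSemidef) : S.trace ≤ Fintype.card ι * σ := by
  have := h.trace_nonneg
  rw [trace_sub, trace_smul, trace_one, smul_eq_mul] at this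
  linarith

lemma sum_sq_le_of_posSemidef_sub {S : Matrix ι ι ℝ} {σ : ℝ} (hσ : 0 ≤ σ) (hS : S.PosSemidef)
    (h : (σ • (1 : Matrix ι ι ℝ) - S).PosSemidef) :
    ∑ i, ∑ j, S i j ^ 2 ≤ Fintype.card ι * σ ^ 2 := by
  have hcross := trace_mul_nonneg h hS
  rw [sub_mul, smul_mul, one_mul, trace_sub, trace_smul, smul_eq_mul,
    trace_mul_self_eq_sum_sq hS.isHermitian] at hcross
  nlinarith [mul_le_mul_of_nonneg_left (trace_le_of_posSemidef_sub h) hσ]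

lemma sum_diag_mul_diag_add_sq_le {S : Matrix ι ι ℝ} {σ : ℝ} (hσ : 0 ≤ σ) (hS : S.PosSemidef)
    (h : (σ • (1 : Matrix ι ι ℝ) - S).PosSemidef) :
    ∑ i, ∑ j, (S i i * S j j + S i j ^ 2) ≤
      Fintype.card ι * (Fintype.card ι + 1) * σ ^ 2 := by
  have htrace : ∑ i, ∑ j, S i i * S j j = S.trace ^ 2 := by
    rw [← Finset.sum_mul_sum, ← pow_two]; rfl
  simp only [Finset.sum_add_distrib]
  rw [htrace]
  nlinarith [pow_le_pow_left₀ hS.trace_nonneg (trace_le_of_posSemidef_sub h) 2,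
    sum_sq_le_of_posSemidef_sub hσ hS h]

lemma posSemidef_smul_one_add_of_sum_sq_le {E : Matrix ι ι ℝ} {c : ℝ} (hE : E.IsHermitian)
    (hc : 0 ≤ c) (hle : ∑ i, ∑ j, E i j ^ 2 ≤ c ^ 2) :
    (c • (1 : Matrix ι ι ℝ) + E).PosSemidef := by
  refine PosSemidef.of_dotProduct_mulVec_nonneg ?_ fun v => ?_
  · exact (isHermitian_one.smul (IsSelfAdjoint.all c)).add hE
  · have hv : 0 ≤ v ⬝ᵥ v := by simpa only [star_trivial] using dotProduct_self_star_nonneg v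
    have hsq : (v ⬝ᵥ (E *ᵥ v)) ^ 2 ≤ (c * (v ⬝ᵥ v)) ^ 2 := by
      rw [mul_pow]
      exact (dotProduct_mulVec_sq_le E v).trans (by gcongr)
    have hlower := (abs_le_of_sq_le_sq' hsq (mul_nonneg hc hv)).1
    rw [star_trivial, add_mulVec, dotProduct_add, smul_mulVec, one_mulVec, dotProduct_smul,
      smul_eq_mul]
    linarith

-- The two Schur complements of the block matrix `[[M, A], [Aᵀ, 1]]` are `M - A Aᵀ` and
-- `1 - Aᵀ M⁻¹ A`.
lemma dotProduct_inv_mulVec_le {M : Matrix ι ι ℝ} {A : Matrix ι κ ℝ} (hM : M.PosDef)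
    (hle : (M - A * Aᵀ).PosSemidef) (ξ : κ → ℝ) :
    (A *ᵥ ξ) ⬝ᵥ (M⁻¹ *ᵥ (A *ᵥ ξ)) ≤ ξ ⬝ᵥ ξ := by
  classical
  have := hM.isUnit.invertible
  have := invertibleOne (α := Matrix κ κ ℝ)
  have hblock : (fromBlocks M A Aᴴ 1).PosSemidef := by
    rw [PosDef.one.fromBlocks₂₂, inv_one, Matrix.mul_one]
    simpa only [conjTranspose_eq_transpose_of_trivial] using hle
  have hschur := ((hM.fromBlocks₁₁ A 1).1 hblock).dotProduct_mulVec_nonneg ξ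
  rw [star_trivial, sub_mulVec, one_mulVec, dotProduct_sub, conjTranspose_eq_transpose_of_trivial,
    ← mulVec_mulVec, ← mulVec_mulVec, dotProduct_mulVec ξ, vecMul_transpose] at hschur
  exact sub_nonneg.1 hschur

variable {n : ℕ}

lemma empCov_posSemidef (w : ℕ → Vec n) {t : ℕ} (ht : 1 ≤ t) : (empCov w t).PosSemidef := by
  refine PosSemidef.smul (posSemidef_sum _ fun k _ => ?_) ?_
  · simpa only [star_trivial] using posSemidef_vecMulVec_self_star (w k - empMean w t).ofLp
  · exact one_div_nonneg.2 (sub_nonneg.2 (by exact_mod_cast ht))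

lemma inflatedCov_posDef (w : ℕ → Vec n) {t : ℕ} (ht : 2 ≤ t) (hn : 0 < n) {σ δ : ℝ}
    (hσ : 0 < σ) (hδ : 0 < δ) : (inflatedCov σ δ w t).PosDef := by
  have ht' : (0 : ℝ) < (t : ℝ) - 1 := sub_pos.2 (by exact_mod_cast ht)
  refine PosDef.posSemidef_add (empCov_posSemidef w (by omega)) (PosDef.one.smul ?_)
  positivity

end MatrixBounds

section CenteringMatrix

variable {ι : Type*} [Fintype ι] [DecidableEq ι]

variable (ι) in
/-- The centering matrix `1 - (1 / N) J`, with `N` the size of the sample and `J` the all-ones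
matrix; it sends a sample to its deviations from the sample mean. -/
noncomputable def centering : Matrix ι ι ℝ := 1 - of fun _ _ => 1 / (Fintype.card ι : ℝ)

lemma isHermitian_centering : (centering ι).IsHermitian := by
  ext k l
  simp [centering, one_apply, eq_comm]

lemma sum_centering_mul (k : ι) (a : ι → ℝ) :
    ∑ l, centering ι k l * a l = a k - 1 / (Fintype.card ι : ℝ) * ∑ l, a l := by
  simp [centering, sub_mul, Finset.sum_sub_distrib, one_apply, Finset.mul_sum]

variable [Nonempty ι]

lemma centering_mul_self : centering ι * centering ι = centering ι := by
  have hcol : ∀ l, ∑ m, centering ι m l = 0 := fun l => by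
    simp [centering, Finset.sum_sub_distrib, one_apply]
  ext k l
  rw [mul_apply, sum_centering_mul, hcol, mul_zero, sub_zero]

lemma trace_centering : (centering ι).trace = Fintype.card ι - 1 := by
  simp [centering, trace]

lemma sum_centering_sq : ∑ k, ∑ l, centering ι k l ^ 2 = Fintype.card ι - 1 := by
  rw [← trace_mul_self_eq_sum_sq isHermitian_centering, centering_mul_self, trace_centering]

lemma dotProduct_centering (k l : ι) : centering ι k ⬝ᵥ centering ι l = centering ι k l := by
  have hsymm : ∀ m, centering ι l m = centering ι m l := fun m => by
    simpa only [star_trivial] using isHermitian_centering.apply m l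
  simp only [dotProduct, hsymm, ← mul_apply, centering_mul_self]

end CenteringMatrix

section WhiteNoise

variable {ι κ : Type*} [DecidableEq ι] {Ω : Type*} [MeasurableSpace Ω] {P : Measure Ω}

/-- White noise in the wide sense: square-integrable vectors with common mean `μ` and common
covariance `S`, pairwise uncorrelated. This is all that the first two moments of the sample mean
and of the residuals depend on. -/
structure IsWhiteNoise (w : ι → Ω → EuclideanSpace ℝ κ) (μ : EuclideanSpace ℝ κ)
    (S : Matrix κ κ ℝ) (P : Measure Ω) : Prop where
  memLp_apply : ∀ k i, MemLp (fun ω => w k ω i) 2 P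
  integral_apply : ∀ k i, ∫ ω, w k ω i ∂P = μ i
  covariance_apply : ∀ k l i j,
    cov[fun ω => w k ω i, fun ω => w l ω j; P] = if k = l then S i j else 0

variable {w : ι → Ω → EuclideanSpace ℝ κ} {μ : EuclideanSpace ℝ κ} {S : Matrix κ κ ℝ}

lemma isWhiteNoise_of_iIndepFun [Fintype κ] [DecidableEq κ] (hS : S.PosSemidef)
    (hindep : iIndepFun w P) (hlaw : ∀ k, HasLaw (w k) (multivariateGaussian μ S) P) :
    IsWhiteNoise w μ S P := by
  have hmem : ∀ k i, MemLp (fun ω => w k ω i) 2 P := fun k i =>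
    ((hlaw k).hasGaussianLaw.map_fun (EuclideanSpace.proj (𝕜 := ℝ) i)).memLp_two
  refine ⟨hmem, fun k i => ?_, fun k l i j => ?_⟩
  · have hcomm := (EuclideanSpace.proj (𝕜 := ℝ) (ι := κ) i).integral_comp_comm
      (hlaw k).hasGaussianLaw.integrable
    rwa [(hlaw k).integral_eq, integral_id_multivariateGaussian] at hcomm
  · split_ifs with hkl
    · rw [← hkl, ← covariance_eval_multivariateGaussian (μ := μ) hS i j]
      exact (hlaw k).covariance_fun_comp (f := fun x => x i) (g := fun x => x j)
        (by fun_prop) (by fun_prop)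
    · have hcoord : IndepFun (fun ω => w k ω i) (fun ω => w l ω j) P :=
        (hindep.indepFun hkl).comp (φ := fun x : EuclideanSpace ℝ κ => x i)
          (ψ := fun x : EuclideanSpace ℝ κ => x j) (by fun_prop) (by fun_prop)
      exact hcoord.covariance_eq_zero (hmem k i) (hmem l j)

namespace IsWhiteNoise

variable [Fintype ι]

lemma memLp_sum_mul (hw : IsWhiteNoise w μ S P) (c : ι → ℝ) (i : κ) :
    MemLp (fun ω => ∑ k, c k * w k ω i) 2 P :=
  memLp_finsetSum _ fun k _ => (hw.memLp_apply k i).const_mul (c k)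

variable [IsFiniteMeasure P]

lemma integral_sum_mul (hw : IsWhiteNoise w μ S P) (c : ι → ℝ) (i : κ) :
    ∫ ω, ∑ k, c k * w k ω i ∂P = (∑ k, c k) * μ i := by
  rw [integral_finsetSum _ fun k _ =>
    ((hw.memLp_apply k i).integrable one_le_two).const_mul (c k)]
  simp only [integral_const_mul, hw.integral_apply, Finset.sum_mul]

lemma covariance_sum_mul (hw : IsWhiteNoise w μ S P) (c d : ι → ℝ) (i j : κ) :
    cov[fun ω => ∑ k, c k * w k ω i, fun ω => ∑ k, d k * w k ω j; P] = (c ⬝ᵥ d) * S i j := by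
  rw [covariance_fun_sum_fun_sum (fun k => (hw.memLp_apply k i).const_mul (c k))
    fun k => (hw.memLp_apply k j).const_mul (d k)]
  simp only [covariance_const_mul_left, covariance_const_mul_right, hw.covariance_apply, mul_ite,
    mul_zero, Finset.sum_ite_eq, Finset.mem_univ, if_true, dotProduct, Finset.sum_mul,
    mul_assoc, mul_left_comm (c _)]

end IsWhiteNoise

end WhiteNoise

section Residuals

variable {ι κ : Type*} [Fintype ι] [DecidableEq ι]

/-- The coordinate `i` of the deviation of `w k` from the sample mean of `w`. -/
noncomputable def residual (w : ι → EuclideanSpace ℝ κ) (k : ι) (i : κ) : ℝ :=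
  ∑ l, centering ι k l * w l i

variable {Ω : Type*} [MeasurableSpace Ω] {P : Measure Ω} {w : ι → Ω → EuclideanSpace ℝ κ}
  {μ : EuclideanSpace ℝ κ} {S : Matrix κ κ ℝ}

lemma hasGaussianLaw_residual [Finite κ] (hG : HasGaussianLaw (fun ω k => w k ω) P) :
    HasGaussianLaw (fun ω (q : ι × κ) => residual (fun k => w k ω) q.1 q.2) P := by
  have := Fintype.ofFinite κ
  convert! hG.map_fun (ContinuousLinearMap.pi fun q : ι × κ => ∑ l, centering ι q.1 l •
    (EuclideanSpace.proj (𝕜 := ℝ) q.2).comp (ContinuousLinearMap.proj l)) using 3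
  simp [residual]

lemma memLp_sum_residual_mul [Finite κ] (hG : HasGaussianLaw (fun ω k => w k ω) P) (i j : κ) :
    MemLp (fun ω => ∑ k, residual (fun k => w k ω) k i * residual (fun k => w k ω) k j) 2 P :=
  memLp_finsetSum _ fun k _ => memLp_mul_of_hasGaussianLaw
    ((hasGaussianLaw_residual hG).eval (k, i)) ((hasGaussianLaw_residual hG).eval (k, j))

variable [Nonempty ι] [IsFiniteMeasure P]

lemma integral_residual (hw : IsWhiteNoise w μ S P) (k : ι) (i : κ) :
    ∫ ω, residual (fun k => w k ω) k i ∂P = 0 := by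
  have hrow : ∑ l, centering ι k l = 0 := by simpa using sum_centering_mul k 1
  simp only [residual, hw.integral_sum_mul, hrow, zero_mul]

lemma covariance_residual (hw : IsWhiteNoise w μ S P) (k l : ι) (i j : κ) :
    cov[fun ω => residual (fun k => w k ω) k i, fun ω => residual (fun k => w k ω) l j; P] =
      centering ι k l * S i j := by
  simp only [residual, hw.covariance_sum_mul, dotProduct_centering]

lemma integral_sum_residual_mul (hw : IsWhiteNoise w μ S P) (i j : κ) :
    ∫ ω, ∑ k, residual (fun k => w k ω) k i * residual (fun k => w k ω) k j ∂P =
      (Fintype.card ι - 1) * S i j := by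
  have hint : ∀ k,
      Integrable (fun ω => residual (fun k => w k ω) k i * residual (fun k => w k ω) k j) P :=
    fun k => (hw.memLp_sum_mul _ i).integrable_mul (hw.memLp_sum_mul _ j)
  rw [integral_finsetSum _ fun k _ => hint k]
  simp only [← covariance_eq_integral_mul (integral_residual hw _ _) (integral_residual hw _ _),
    covariance_residual hw, ← Finset.sum_mul, ← trace_centering (ι := ι), trace, diag_apply]

lemma variance_sum_residual_mul [Finite κ] (hw : IsWhiteNoise w μ S P)
    (hG : HasGaussianLaw (fun ω k => w k ω) P) (hS : S.IsHermitian) (i j : κ) :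
    Var[fun ω => ∑ k, residual (fun k => w k ω) k i * residual (fun k => w k ω) k j; P] =
      (Fintype.card ι - 1) * (S i i * S j j + S i j ^ 2) := by
  have hR := hasGaussianLaw_residual hG
  have hcov : ∀ k l, cov[fun ω => residual (fun k => w k ω) k i * residual (fun k => w k ω) k j,
      fun ω => residual (fun k => w k ω) l i * residual (fun k => w k ω) l j; P] =
        centering ι k l ^ 2 * (S i i * S j j + S i j ^ 2) := fun k l => by
    rw [covariance_mul_mul_of_hasGaussianLaw
      (X := fun (q : ι × κ) ω => residual (fun k => w k ω) q.1 q.2) hR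
      (fun q => integral_residual hw q.1 q.2) (k, i) (k, j) (l, i) (l, j)]
    simp only [covariance_residual hw]
    rw [show S j i = S i j by simpa only [star_trivial] using hS.apply i j]
    ring
  rw [variance_fun_sum fun k => memLp_mul_of_hasGaussianLaw (hR.eval (k, i)) (hR.eval (k, j))]
  simp only [hcov, ← Finset.sum_mul, sum_centering_sq]

end Residuals

section SampleMoments

variable {n : ℕ}

lemma empMean_apply (w : ℕ → Vec n) (t : ℕ) (i : Fin n) :
    empMean w t i = ∑ k : Fin t, 1 / (t : ℝ) * w k i := by
  simp [empMean, Finset.sum_range, Finset.mul_sum]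

lemma empCov_apply (w : ℕ → Vec n) (t : ℕ) (i j : Fin n) :
    empCov w t i j = 1 / ((t : ℝ) - 1) *
      ∑ k : Fin t, residual (fun k : Fin t => w k) k i * residual (fun k : Fin t => w k) k j := by
  simp [empCov, residual, sum_centering_mul, empMean_apply, Finset.sum_range, Matrix.sum_apply,
    vecMulVec_apply, Finset.mul_sum]

variable {Ω : Type*} [MeasurableSpace Ω] {P : Measure Ω} {w : ℕ → Ω → Vec n} {t : ℕ} {μ : Vec n}
  {S : Matrix (Fin n) (Fin n) ℝ}

lemma memLp_empMean (hw : IsWhiteNoise (fun k : Fin t => w k) μ S P) (i : Fin n) :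
    MemLp (fun ω => empMean (fun k => w k ω) t i) 2 P := by
  simpa only [empMean_apply] using hw.memLp_sum_mul (fun _ => 1 / (t : ℝ)) i

lemma memLp_empCov (hG : HasGaussianLaw (fun ω (k : Fin t) => w k ω) P) (i j : Fin n) :
    MemLp (fun ω => empCov (fun k => w k ω) t i j) 2 P := by
  simpa only [empCov_apply] using
    (memLp_sum_residual_mul (w := fun k : Fin t => w k) hG i j).const_mul (1 / ((t : ℝ) - 1))

variable [IsFiniteMeasure P]

lemma integral_empMean (hw : IsWhiteNoise (fun k : Fin t => w k) μ S P) (ht : 0 < t)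
    (i : Fin n) : ∫ ω, empMean (fun k => w k ω) t i ∂P = μ i := by
  simp only [empMean_apply, hw.integral_sum_mul]
  simp [ht.ne']

lemma variance_empMean (hw : IsWhiteNoise (fun k : Fin t => w k) μ S P) (i : Fin n) :
    Var[fun ω => empMean (fun k => w k ω) t i; P] = S i i / t := by
  rw [← covariance_self (memLp_empMean hw i).aemeasurable]
  simp only [empMean_apply, hw.covariance_sum_mul]
  simp [dotProduct]
  field_simp

lemma integral_empCov (hw : IsWhiteNoise (fun k : Fin t => w k) μ S P) (ht : 2 ≤ t)
    (i j : Fin n) : ∫ ω, empCov (fun k => w k ω) t i j ∂P = S i j := by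
  have : Nonempty (Fin t) := ⟨⟨0, by omega⟩⟩
  have ht' : (t : ℝ) - 1 ≠ 0 := (sub_pos.2 (by exact_mod_cast ht)).ne'
  simp only [empCov_apply, integral_const_mul, integral_sum_residual_mul hw, Fintype.card_fin]
  field_simp

lemma variance_empCov (hw : IsWhiteNoise (fun k : Fin t => w k) μ S P)
    (hG : HasGaussianLaw (fun ω (k : Fin t) => w k ω) P) (hS : S.IsHermitian) (ht : 2 ≤ t)
    (i j : Fin n) :
    Var[fun ω => empCov (fun k => w k ω) t i j; P] =
      (S i i * S j j + S i j ^ 2) / ((t : ℝ) - 1) := by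
  have : Nonempty (Fin t) := ⟨⟨0, by omega⟩⟩
  have ht' : (t : ℝ) - 1 ≠ 0 := (sub_pos.2 (by exact_mod_cast ht)).ne'
  simp only [empCov_apply, variance_const_mul, variance_sum_residual_mul hw hG hS,
    Fintype.card_fin]
  field_simp

end SampleMoments

section Concentration

variable {Ω : Type*} [MeasurableSpace Ω] {P : Measure Ω}

lemma measureReal_lt_sum_sq_le [IsFiniteMeasure P] {ι : Type*} [Fintype ι] {Y : ι → Ω → ℝ}
    (hY : ∀ a, MemLp (Y a) 2 P) {r : ℝ} (hr : 0 < r) :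
    P.real {ω | r < ∑ a, (Y a ω - P[Y a]) ^ 2} ≤ (∑ a, Var[Y a; P]) / r := by
  have hint : ∀ a, Integrable (fun ω => (Y a ω - P[Y a]) ^ 2) P := fun a =>
    ((hY a).sub (memLp_const _)).integrable_sq
  have hmarkov := mul_meas_ge_le_integral_of_nonneg (f := fun ω => ∑ a, (Y a ω - P[Y a]) ^ 2)
    (Filter.Eventually.of_forall fun ω => Finset.sum_nonneg fun a _ => sq_nonneg (Y a ω - P[Y a]))
    (integrable_finsetSum _ fun a _ => hint a) r
  rw [integral_finsetSum _ fun a _ => hint a] at hmarkov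
  simp only [← variance_eq_integral (hY _).aemeasurable] at hmarkov
  rw [le_div_iff₀' hr]
  refine le_trans ?_ hmarkov
  exact mul_le_mul_of_nonneg_left (measureReal_mono fun ω (hω : r < _) => hω.le) hr.le

lemma one_sub_measureReal_and_not_le [IsProbabilityMeasure P] {F G : Ω → Prop}
    (hF : ∀ᵐ ω ∂P, F ω) :
    1 - P.real {ω | F ω ∧ ¬ G ω} ≤ P.real {ω | G ω} := by
  have hcompl : P.real {ω | F ω ∧ ¬ G ω} = P.real {ω | G ω}ᶜ :=
    measureReal_congr (hF.mono fun ω hω => propext ⟨And.right, fun hG => ⟨hω, hG⟩⟩)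
  have hcover := measureReal_union_le (μ := P) {ω | G ω} {ω | G ω}ᶜ
  rw [Set.union_compl_self, probReal_univ, ← hcompl] at hcover
  linarith

variable {ι : Type*} [Fintype ι]

lemma measureReal_stdGaussian_lt_norm_sq_le {r : ℝ} (hr : 0 < r) :
    (stdGaussian (EuclideanSpace ℝ ι)).real {ξ | r < ‖ξ‖ ^ 2} ≤ Fintype.card ι / r := by
  classical
  have hlaw : HasLaw id (multivariateGaussian 0 1) (stdGaussian (EuclideanSpace ℝ ι)) := by
    rw [multivariateGaussian_zero_one]; exact HasLaw.id
  have hwhite : IsWhiteNoise (fun _ : Unit => id) 0 1 (stdGaussian (EuclideanSpace ℝ ι)) :=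
    isWhiteNoise_of_iIndepFun PosSemidef.one (iIndepFun.of_subsingleton) fun _ => hlaw
  have hmean : ∀ i, ∫ ξ : EuclideanSpace ℝ ι, ξ i ∂stdGaussian _ = 0 := fun i =>
    hwhite.integral_apply () i
  have hvar : ∀ i, Var[fun ξ : EuclideanSpace ℝ ι => ξ i; stdGaussian _] = 1 := fun i => by
    rw [← covariance_self (by fun_prop)]
    simpa using hwhite.covariance_apply () () i i
  have hcheb := measureReal_lt_sum_sq_le (fun i => hwhite.memLp_apply () i) hr
  simpa [EuclideanSpace.real_norm_sq_eq, hmean, hvar] using hcheb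

variable [DecidableEq ι]

/-- The covariance ellipsoid `{μ + S^(1/2) ξ : ‖ξ‖² ≤ r}`. For positive definite `S` these are the
points with `(x - μ)ᵀ S⁻¹ (x - μ) ≤ r`; the parametrization by `ξ` also covers singular `S`. -/
def covEllipsoid (μ : EuclideanSpace ℝ ι) (S : Matrix ι ι ℝ) (r : ℝ) : Set (EuclideanSpace ℝ ι) :=
  (fun ξ => μ + toEuclideanCLM (𝕜 := ℝ) (CFC.sqrt S) ξ) '' {ξ | ‖ξ‖ ^ 2 ≤ r}

lemma measurableSet_covEllipsoid (μ : EuclideanSpace ℝ ι) (S : Matrix ι ι ℝ) (r : ℝ) :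
    MeasurableSet (covEllipsoid μ S r) := by
  have hcompact : IsCompact {ξ : EuclideanSpace ℝ ι | ‖ξ‖ ^ 2 ≤ r} :=
    (isCompact_closedBall 0 (Real.sqrt r)).of_isClosed_subset
      (isClosed_le (by fun_prop) continuous_const) fun ξ hξ => by
        simpa using Real.le_sqrt_of_sq_le hξ
  exact (hcompact.image (by fun_prop)).isClosed.measurableSet

lemma measureReal_notMem_covEllipsoid_le {μ : EuclideanSpace ℝ ι} {S : Matrix ι ι ℝ}
    {X : Ω → EuclideanSpace ℝ ι} (hX : HasLaw X (multivariateGaussian μ S) P) {r : ℝ} (hr : 0 < r) :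
    P.real {ω | X ω ∉ covEllipsoid μ S r} ≤ Fintype.card ι / r := by
  have hmeas := (measurableSet_covEllipsoid μ S r).compl
  rw [hX.measureReal_eq (p := fun x => x ∉ covEllipsoid μ S r) hmeas, multivariateGaussian]
  refine (map_measureReal_apply (by fun_prop) hmeas).trans_le ?_
  refine (measureReal_mono fun ξ hξ => ?_).trans (measureReal_stdGaussian_lt_norm_sq_le hr)
  exact not_le.1 fun hle : ‖ξ‖ ^ 2 ≤ r => hξ ⟨ξ, hle, rfl⟩

end Concentration

section UncertaintySet

variable {n t : ℕ} {σ δ : ℝ} {μ : Vec n} {S : Matrix (Fin n) (Fin n) ℝ}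

lemma inflatedCov_sub_posSemidef {w : ℕ → Vec n} (ht : 2 ≤ t) (hσ : 0 ≤ σ) (hS : S.IsHermitian)
    (hcov : ∑ i, ∑ j, (empCov w t i j - S i j) ^ 2 ≤
      (σ * Real.sqrt (3 * (n : ℝ) * ((n : ℝ) + 1) / (δ * ((t : ℝ) - 1)))) ^ 2) :
    (inflatedCov σ δ w t - S).PosSemidef := by
  have hE := (empCov_posSemidef w (one_le_two.trans ht)).isHermitian.sub hS
  convert! posSemidef_smul_one_add_of_sum_sq_le hE (by positivity) hcov using 1
  rw [inflatedCov]
  abel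

lemma mem_uncertaintySet {w : ℕ → Vec n} {x : Vec n} (hn : 0 < n) (ht : 2 ≤ t) (hσ : 0 < σ)
    (hδ : 0 < δ) (hS : S.PosSemidef)
    (hmean : ∑ i, (empMean w t i - μ i) ^ 2 ≤ 3 * (n : ℝ) * σ / ((t : ℝ) * δ))
    (hcov : ∑ i, ∑ j, (empCov w t i j - S i j) ^ 2 ≤
      (σ * Real.sqrt (3 * (n : ℝ) * ((n : ℝ) + 1) / (δ * ((t : ℝ) - 1)))) ^ 2)
    (hx : x ∈ covEllipsoid μ S (3 * (n : ℝ) / δ)) : x ∈ uncertaintySet σ δ w t := by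
  obtain ⟨ξ, hξ, rfl⟩ := hx
  refine ⟨μ - empMean w t, ?_, ?_⟩
  · simpa only [dotProduct, PiLp.sub_apply, ← pow_two, sub_sq_comm] using hmean
  · have hcenter : (μ + toEuclideanCLM (𝕜 := ℝ) (CFC.sqrt S) ξ - empMean w t -
        (μ - empMean w t)).ofLp = CFC.sqrt S *ᵥ ξ.ofLp := by
      rw [← ofLp_toEuclideanCLM]
      congr 1
      abel
    have hnorm : ξ.ofLp ⬝ᵥ ξ.ofLp = ‖ξ‖ ^ 2 := by
      rw [EuclideanSpace.real_norm_sq_eq]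
      simp only [dotProduct, pow_two]
    rw [hcenter]
    refine (dotProduct_inv_mulVec_le (inflatedCov_posDef w ht hn hσ hδ) ?_ ξ.ofLp).trans
      (hnorm.trans_le hξ)
    rw [sqrt_mul_transpose_sqrt hS]
    exact inflatedCov_sub_posSemidef ht hσ.le hS.isHermitian hcov

variable {Ω : Type*} [MeasurableSpace Ω] {P : Measure Ω} [IsFiniteMeasure P] {w : ℕ → Ω → Vec n}

lemma measureReal_lt_sum_sq_empMean_sub_le (hn : 0 < n) (ht : 0 < t) (hσ : 0 < σ) (hδ : 0 < δ)
    (hSσ : (σ • (1 : Matrix (Fin n) (Fin n) ℝ) - S).PosSemidef)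
    (hw : IsWhiteNoise (fun k : Fin t => w k) μ S P) :
    P.real {ω | 3 * (n : ℝ) * σ / ((t : ℝ) * δ) <
      ∑ i, (empMean (fun k => w k ω) t i - μ i) ^ 2} ≤ δ / 3 := by
  have hcheb := measureReal_lt_sum_sq_le (fun i => memLp_empMean hw i)
    (show 0 < 3 * (n : ℝ) * σ / ((t : ℝ) * δ) by positivity)
  simp only [integral_empMean hw ht, variance_empMean hw, ← Finset.sum_div] at hcheb
  have htrace : ∑ i, S i i ≤ n * σ := by
    simpa only [trace, diag_apply, Fintype.card_fin] using trace_le_of_posSemidef_sub hSσ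
  calc _ ≤ _ := hcheb
    _ ≤ n * σ / t / (3 * (n : ℝ) * σ / ((t : ℝ) * δ)) := by gcongr
    _ = δ / 3 := by field_simp

lemma measureReal_lt_sum_sq_empCov_sub_le (hn : 0 < n) (ht : 2 ≤ t) (hσ : 0 < σ) (hδ : 0 < δ)
    (hS : S.PosSemidef) (hSσ : (σ • (1 : Matrix (Fin n) (Fin n) ℝ) - S).PosSemidef)
    (hw : IsWhiteNoise (fun k : Fin t => w k) μ S P)
    (hG : HasGaussianLaw (fun ω (k : Fin t) => w k ω) P) :
    P.real {ω | (σ * Real.sqrt (3 * (n : ℝ) * ((n : ℝ) + 1) / (δ * ((t : ℝ) - 1)))) ^ 2 <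
      ∑ i, ∑ j, (empCov (fun k => w k ω) t i j - S i j) ^ 2} ≤ δ / 3 := by
  have ht' : (0 : ℝ) < (t : ℝ) - 1 := sub_pos.2 (by exact_mod_cast ht)
  have hradius : (σ * Real.sqrt (3 * (n : ℝ) * ((n : ℝ) + 1) / (δ * ((t : ℝ) - 1)))) ^ 2 =
      σ ^ 2 * (3 * (n : ℝ) * ((n : ℝ) + 1) / (δ * ((t : ℝ) - 1))) := by
    rw [mul_pow, Real.sq_sqrt (by positivity)]
  rw [hradius]
  have hcheb := measureReal_lt_sum_sq_le (fun q : Fin n × Fin n => memLp_empCov hG q.1 q.2)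
    (show 0 < σ ^ 2 * (3 * (n : ℝ) * ((n : ℝ) + 1) / (δ * ((t : ℝ) - 1))) by positivity)
  simp only [Fintype.sum_prod_type, integral_empCov hw ht,
    variance_empCov hw hG hS.isHermitian ht, ← Finset.sum_div] at hcheb
  have hvar : ∑ i, ∑ j, (S i i * S j j + S i j ^ 2) ≤ n * (n + 1) * σ ^ 2 := by
    simpa only [Fintype.card_fin] using sum_diag_mul_diag_add_sq_le hσ.le hS hSσ
  calc _ ≤ _ := hcheb
    _ ≤ n * (n + 1) * σ ^ 2 / ((t : ℝ) - 1) /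
        (σ ^ 2 * (3 * (n : ℝ) * ((n : ℝ) + 1) / (δ * ((t : ℝ) - 1)))) := by gcongr
    _ = δ / 3 := by field_simp

lemma measureReal_notMem_uncertaintySet_le (hS : S.PosSemidef) (hσ : 0 < σ)
    (hSσ : (σ • (1 : Matrix (Fin n) (Fin n) ℝ) - S).PosSemidef) (hδ : 0 < δ) (ht : 2 ≤ t)
    (hindep : iIndepFun (fun k : Fin t => w k) P)
    (hlaw : ∀ k : Fin t, HasLaw (w k) (multivariateGaussian μ S) P) {x : Ω → Vec n}
    (hx : HasLaw x (multivariateGaussian μ S) P) :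
    P.real {ω | x ω ∉ uncertaintySet σ δ (fun k => w k ω) t} ≤ δ := by
  rcases n.eq_zero_or_pos with rfl | hn
  · simpa [uncertaintySet, dotProduct] using hδ.le
  have hw := isWhiteNoise_of_iIndepFun hS hindep hlaw
  have hG := iIndepFun.hasGaussianLaw (fun k => (hlaw k).hasGaussianLaw) hindep
  have hmean := measureReal_lt_sum_sq_empMean_sub_le hn (by omega) hσ hδ hSσ hw
  have hcov := measureReal_lt_sum_sq_empCov_sub_le hn ht hσ hδ hS hSσ hw hG
  have hellipsoid : P.real {ω | x ω ∉ covEllipsoid μ S (3 * (n : ℝ) / δ)} ≤ δ / 3 :=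
    by
    refine (measureReal_notMem_covEllipsoid_le hx (by positivity)).trans_eq ?_
    rw [Fintype.card_fin]
    field_simp
  have hunion := (measureReal_union_le _ _).trans
    (add_le_add ((measureReal_union_le _ _).trans (add_le_add hmean hcov)) hellipsoid)
  refine (measureReal_mono fun ω hω => ?_).trans (hunion.trans_eq (by ring))
  by_contra hgood
  simp only [Set.mem_union, Set.mem_ofPred_eq, not_or, not_lt, not_not] at hgood
  exact hω (mem_uncertaintySet hn ht hσ hδ hS hgood.1.1 hgood.1.2 hgood.2)

end UncertaintySet

lemma measureReal_feasible_and_not_isSafe_le {n m p : ℕ} {f : Vec n → Vec n}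
    {g : Vec n → Matrix (Fin n) (Fin m) ℝ} {H : Matrix (Fin p) (Fin n) ℝ} {h : Fin p → ℝ}
    {Ω : Type*} [MeasurableSpace Ω] {P : Measure Ω} [IsFiniteMeasure P] {W : Ω → Set (Vec n)}
    {x x' v : Ω → Vec n} {u : Ω → Vec m}
    (hstep : ∀ᵐ ω ∂P, x' ω = step f g (x ω) (u ω) (v ω))
    (hu : ∀ᵐ ω ∂P, (feasibleControls f g H h (W ω) (x ω)).Nonempty →
      u ω ∈ feasibleControls f g H h (W ω) (x ω)) :
    P.real {ω | (feasibleControls f g H h (W ω) (x ω)).Nonempty ∧ ¬ IsSafe H h (x' ω)} ≤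
      P.real {ω | v ω ∉ W ω} := by
  refine ENNReal.toReal_mono (measure_ne_top _ _) (measure_mono_ae ?_)
  filter_upwards [hstep, hu] with ω hstepω huω hbad hv
  exact hbad.2 (hstepω ▸ huω hbad.1 (v ω) hv)

end SafeLearning

theorem theorem8_general {n m p : ℕ} {Ω : Type*} [MeasurableSpace Ω] (P : Measure Ω)
    [IsProbabilityMeasure P] (f : SafeLearning.Vec n → SafeLearning.Vec n)
    (g : SafeLearning.Vec n → Matrix (Fin n) (Fin m) ℝ)
    (H : Matrix (Fin p) (Fin n) ℝ) (h : Fin p → ℝ)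
    (μw : SafeLearning.Vec n) (Sw : Matrix (Fin n) (Fin n) ℝ) (hSw : Sw.PosSemidef)
    (σ : ℝ) (hσ : 0 < σ) (hSσ : (σ • (1 : Matrix (Fin n) (Fin n) ℝ) - Sw).PosSemidef)
    (δ : ℝ) (hδ : 0 < δ) (t : ℕ) (ht : 2 ≤ t) (w : ℕ → Ω → SafeLearning.Vec n)
    (hw_indep : iIndepFun (fun k : Fin t => w k) P)
    (hw_law : ∀ k ≤ t, HasLaw (w k) (multivariateGaussian μw Sw) P)
    (x x' : Ω → SafeLearning.Vec n) (u : Ω → SafeLearning.Vec m)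
    (hx : ∀ᵐ ω ∂P, x' ω = SafeLearning.step f g (x ω) (u ω) (w t ω))
    (hu : ∀ᵐ ω ∂P,
      (SafeLearning.feasibleControls f g H h
        (SafeLearning.uncertaintySet σ δ (fun k => w k ω) t) (x ω)).Nonempty →
      u ω ∈ SafeLearning.feasibleControls f g H h
        (SafeLearning.uncertaintySet σ δ (fun k => w k ω) t) (x ω)) :
    P.real {ω |
        (SafeLearning.feasibleControls f g H h
          (SafeLearning.uncertaintySet σ δ (fun k => w k ω) t) (x ω)).Nonempty ∧
        ¬ SafeLearning.IsSafe H h (x' ω)} ≤ δ ∧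
    ((∀ᵐ ω ∂P,
        (SafeLearning.feasibleControls f g H h
          (SafeLearning.uncertaintySet σ δ (fun k => w k ω) t) (x ω)).Nonempty) →
      1 - δ ≤ P.real {ω | SafeLearning.IsSafe H h (x' ω)}) := by
  have hdisturbance := SafeLearning.measureReal_notMem_uncertaintySet_le hSw hσ hSσ hδ ht hw_indep
    (fun k => hw_law k k.isLt.le) (hw_law t le_rfl)
  have hviolation := (SafeLearning.measureReal_feasible_and_not_isSafe_le hx hu).trans hdisturbance
  exact ⟨hviolation, fun hfeasible => (sub_le_sub_left hviolation 1).trans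
    (SafeLearning.one_sub_measureReal_and_not_le hfeasible)⟩

/-- The first conclusion bounds the probability that the program is feasible and the next state is
nevertheless unsafe; the second is the safety guarantee for an (almost surely) feasible program. -/
theorem theorem8 {n m : ℕ} {p : ℕ → ℕ}
    {Ω : Type*} [MeasurableSpace Ω] (P : Measure Ω) [IsProbabilityMeasure P]
    (f : SafeLearning.Vec n → SafeLearning.Vec n)
    (g : SafeLearning.Vec n → Matrix (Fin n) (Fin m) ℝ)
    (H : (k : ℕ) → Matrix (Fin (p k)) (Fin n) ℝ) (h : (k : ℕ) → Fin (p k) → ℝ)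
    (d : SafeLearning.Vec m → SafeLearning.Vec m → ℝ)
    (μw : SafeLearning.Vec n) (Sw : Matrix (Fin n) (Fin n) ℝ) (hSw : Sw.PosSemidef)
    (σ : ℝ) (hσ : 0 < σ)
    (hSσ : (σ • (1 : Matrix (Fin n) (Fin n) ℝ) - Sw).PosSemidef)
    (δ : ℝ) (hδ : 0 < δ) (t : ℕ) (ht : 2 ≤ t)
    (x : ℕ → Ω → SafeLearning.Vec n) (u ubar : ℕ → Ω → SafeLearning.Vec m)
    (w : ℕ → Ω → SafeLearning.Vec n)
    (hw_indep : iIndepFun w P)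
    (hw_law : ∀ k, HasLaw (w k) (multivariateGaussian μw Sw) P)
    (hx : ∀ k, ∀ᵐ ω ∂P, x (k + 1) ω = SafeLearning.step f g (x k ω) (u k ω) (w k ω))
    (hu : ∀ᵐ ω ∂P,
      (SafeLearning.feasibleControls f g (H (t + 1)) (h (t + 1))
        (SafeLearning.uncertaintySet σ δ (fun k => w k ω) t) (x t ω)).Nonempty →
      u t ω ∈ SafeLearning.argminControls d (ubar t ω)
        (SafeLearning.feasibleControls f g (H (t + 1)) (h (t + 1))
          (SafeLearning.uncertaintySet σ δ (fun k => w k ω) t) (x t ω))) :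
    P.real {ω |
        (SafeLearning.feasibleControls f g (H (t + 1)) (h (t + 1))
          (SafeLearning.uncertaintySet σ δ (fun k => w k ω) t) (x t ω)).Nonempty ∧
        ¬ SafeLearning.IsSafe (H (t + 1)) (h (t + 1)) (x (t + 1) ω)} ≤ δ ∧
    ((∀ᵐ ω ∂P,
        (SafeLearning.feasibleControls f g (H (t + 1)) (h (t + 1))
          (SafeLearning.uncertaintySet σ δ (fun k => w k ω) t) (x t ω)).Nonempty) →
      1 - δ ≤ P.real {ω | SafeLearning.IsSafe (H (t + 1)) (h (t + 1)) (x (t + 1) ω)}) :=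
  theorem8_general P f g (H (t + 1)) (h (t + 1)) μw Sw hSw σ hσ hSσ δ hδ t ht w
    (hw_indep.precomp Fin.val_injective) (fun k _ => hw_law k) (x t) (x (t + 1)) (u t) (hx t)
    (hu.mono fun _ hω hne => (hω hne).1)
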